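/- Throughout, all spaces are separable and metrizable. A locally compact space $X$ is an absolute retract (AR) if, whenever $X$ is embedded as a closed subset of a space $Z$, its image is a retract of $Z$. A metric space is proper if its closed balls are compact. An action of a group $G$ on a metric space $X$ is geometric if it is by isometries, cocompact ($GK=X$ for some compact $K\subseteq X$) and proper ($\{g\in G: gK\cap K\neq\varnothing\}$ is finite for every compact $K\subseteq X$). Two finitely generated groups are quasi-isometric if they are so with respect to word metrics of finite generating sets. A (not necessarily continuous) function $f:X\to Y$ of metric spaces is coarse if preimages of bounded sets are bounded and for every $R>0$ there is $S>0$ such that $d(x,x')<R$ implies $d(f(x),f(x'))<S$; it is a coarse equivalence if moreover there is a coarse function $g:Y\to X$ with $d(gf(x),x)$ and $d(fg(y),y)$ bounded over $x\in X$ and $y\in Y$. A homotopy $F:X\times[0,1]\to Y$ is bounded if the diameters of the sets $F(\{x\}\times[0,1])$, $x\in X$, are bounded above, and proper if preimages of compact sets are compact. **Theorem.** Let $G$ and $H$ be quasi-isometric finitely generated groups, let $X$ and $Y$ be proper metric spaces that are ARs, and suppose that $G$ acts geometrically on $X$ and $H$ acts geometrically on $Y$. Then $X$ and $Y$ are proper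 homotopy equivalent, that is, there are continuous maps $X\to Y$ and $Y\to X$ whose two composites are homotopic to $\operatorname{id}_X$ and $\operatorname{id}_Y$ via proper homotopies. In fact, there exist continuous coarse equivalences $f:X\to Y$ and $g:Y\to X$ such that $gf$ and $fg$ are homotopic to $\operatorname{id}_X$ and $\operatorname{id}_Y$, respectively, via homotopies that are both bounded and proper. -/

import Mathlib

open Set Topology

universe u v

/-! ### Absolute retracts

All spaces are separable and metrizable, and local compactness is part of the notion. -/

/-- A locally compact, separable, metrizable space `X` is an *absolute retract* if, whenever `X` is
embedded as a closed subset of a separable metrizable space `Y`, its image is a retract of `Y`: for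
each closed embedding `e : X → Y` there is a continuous `r : Y → X` with `r ∘ e = id` (so that
`e ∘ r` is a retraction of `Y` onto `e(X)`).

Every separable metrizable space is homeomorphic to a subspace of `ℝ^ℕ`, hence to a space in any
given universe, so letting `Y` range over the universe of `X` is no restriction. An absolute
retract is nonempty (take for `Y` a one-point space). -/
structure IsAR (X : Type u) [TopologicalSpace X] : Prop where
  locallyCompact : LocallyCompactSpace X
  separable : TopologicalSpace.SeparableSpace X
  metrizable : TopologicalSpace.MetrizableSpace X
  exists_retraction : ∀ (Y : Type u) [TopologicalSpace Y] [TopologicalSpace.MetrizableSpace Y]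
    [TopologicalSpace.SeparableSpace Y] (e : X → Y), IsClosedEmbedding e →
      ∃ r : Y → X, Continuous r ∧ ∀ x, r (e x) = x

/-! ### Geometric actions -/

/-- An action of a (discrete) group on a metric space is *geometric* if it is by isometries,
cocompact, and proper (that is, properly discontinuous). -/
structure IsGeometricAction (G : Type*) [Group G] (X : Type*) [MetricSpace X] [MulAction G X] :
    Prop where
  isometry : ∀ (g : G) (x y : X), dist (g • x) (g • y) = dist x y
  cocompact : ∃ K : Set X, IsCompact K ∧ ∀ x : X, ∃ g : G, ∃ k ∈ K, g • k = x
  proper : ∀ K : Set X, IsCompact K → {g : G | (((g • ·) '' K) ∩ K).Nonempty}.Finite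

/-! ### Word metrics and quasi-isometric groups -/

/-- The word length of `g` with respect to `S`: the least length of a word in the letters
`S ∪ S⁻¹` that represents `g`. (It is used only when `S` generates, so that such words exist.) -/
noncomputable def wordLength {G : Type*} [Group G] (S : Set G) (g : G) : ℕ :=
  sInf {n : ℕ | ∃ l : List G, (∀ s ∈ l, s ∈ S ∨ s⁻¹ ∈ S) ∧ l.prod = g ∧ l.length = n}

/-- The (left-invariant) word metric on `G` with respect to `S`. -/
noncomputable def wordDist {G : Type*} [Group G] (S : Set G) (g h : G) : ℝ :=
  (wordLength S (g⁻¹ * h) : ℝ)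

/-- `f : A → B` is a *quasi-isometry* with respect to the distance functions `dA` and `dB`. -/
def IsQuasiIsometry {A B : Type*} (dA : A → A → ℝ) (dB : B → B → ℝ) (f : A → B) : Prop :=
  ∃ L C : ℝ, 1 ≤ L ∧ 0 ≤ C ∧
    (∀ a a' : A, dA a a' / L - C ≤ dB (f a) (f a') ∧ dB (f a) (f a') ≤ L * dA a a' + C) ∧
    ∀ b : B, ∃ a : A, dB (f a) b ≤ C

/-- Two groups are *quasi-isometric* if they are finitely generated and, with the word metrics of
finite generating sets, quasi-isometric. (The choice of the generating sets does not matter.) -/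
def QuasiIsometricGroups (G H : Type*) [Group G] [Group H] : Prop :=
  ∃ (S : Set G) (T : Set H), S.Finite ∧ T.Finite ∧
    Subgroup.closure S = ⊤ ∧ Subgroup.closure T = ⊤ ∧
    ∃ f : G → H, IsQuasiIsometry (wordDist S) (wordDist T) f

/-! ### Coarse maps; functions are not assumed continuous -/

/-- Preimages of bounded sets are bounded. -/
def MetricallyProper {X Y : Type*} [MetricSpace X] [MetricSpace Y] (f : X → Y) : Prop :=
  ∀ B : Set Y, Bornology.IsBounded B → Bornology.IsBounded (f ⁻¹' B)

/-- Large-scale uniform, also called bornologous. -/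
def LargeScaleUniform {X Y : Type*} [MetricSpace X] [MetricSpace Y] (f : X → Y) : Prop :=
  ∀ R : ℝ, 0 < R → ∃ S : ℝ, 0 < S ∧ ∀ x x' : X, dist x x' < R → dist (f x) (f x') < S

/-- The distances `d(f x, g x)` are bounded above. -/
def BoundedlyClose {X Y : Type*} [MetricSpace Y] (f g : X → Y) : Prop :=
  ∃ K : ℝ, ∀ x : X, dist (f x) (g x) ≤ K

/-- A function is *coarse* if it is metrically proper and large-scale uniform. -/
def IsCoarse {X Y : Type*} [MetricSpace X] [MetricSpace Y] (f : X → Y) : Prop :=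
  MetricallyProper f ∧ LargeScaleUniform f

/-- A *coarse equivalence* is a coarse map that has a coarse inverse. -/
def IsCoarseEquivalence {X Y : Type*} [MetricSpace X] [MetricSpace Y] (f : X → Y) : Prop :=
  IsCoarse f ∧ ∃ g : Y → X, IsCoarse g ∧ BoundedlyClose (g ∘ f) id ∧ BoundedlyClose (f ∘ g) id

/-! ### Bounded and proper homotopies -/

/-- A homotopy is *bounded* if the diameters of its tracks are bounded above. -/
def IsBoundedHomotopy {X Y : Type*} [TopologicalSpace X] [MetricSpace Y] {f g : C(X, Y)}
    (F : f.Homotopy g) : Prop :=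
  ∃ K : ℝ, ∀ (x : X) (s t : unitInterval), dist (F (s, x)) (F (t, x)) ≤ K

/-- `f` and `g` are homotopic via a homotopy `[0,1] × X → Y` that is a proper map. -/
def ProperlyHomotopic {X Y : Type*} [TopologicalSpace X] [TopologicalSpace Y] (f g : C(X, Y)) :
    Prop :=
  ∃ F : f.Homotopy g, IsProperMap F

/-- `f` and `g` are mutually inverse up to proper homotopy. -/
def AreProperHomotopyInverses {X Y : Type*} [TopologicalSpace X] [TopologicalSpace Y]
    (f : C(X, Y)) (g : C(Y, X)) : Prop :=
  ProperlyHomotopic (g.comp f) (ContinuousMap.id X) ∧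
    ProperlyHomotopic (f.comp g) (ContinuousMap.id Y)

/-- `X` and `Y` are proper homotopy equivalent. -/
def ProperHomotopyEquivalent (X Y : Type*) [TopologicalSpace X] [TopologicalSpace Y] : Prop :=
  ∃ (f : C(X, Y)) (g : C(Y, X)), AreProperHomotopyInverses f g

/-! ### Extending maps into absolute retracts with control on the image -/

/-! Orbit maps make `X` coarsely equivalent to `G` and `Y` to `H` (the Milnor–Švarc argument,
`IsGeometricAction.exists_areCoarseInverses`). Composing with the quasi-isometry gives large-scale
uniform functions between `X` and `Y`, inverse to each other up to bounded distance but perhaps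
discontinuous. It remains to approximate them by continuous maps and to join boundedly close
continuous maps by bounded homotopies.

Both are one extension problem. The AR property together with cocompactness gives extensions with
uniform control: a map from a closed set into an `R`-ball extends with values in a concentric
`S`-ball, where `S` depends only on `R` (`IsAR.hasUniformExtension`). The source is covered by the
translates of a compact set, colored with finitely many colors so that translates of one color are
disjoint (`IsGeometricAction.exists_cover`). Correcting a function over one color at a time moves it
a bounded amount at each of finitely many steps
(`HasUniformExtension.exists_continuous_boundedlyClose`). No bound on dimension enters. On `[0,1] ×
X`, relative to the two ends, the same construction produces homotopies, and a bounded homotopy to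
the identity of a proper space is proper. -/

theorem IsAR.nonempty {X : Type u} [TopologicalSpace X] (hX : IsAR X) : Nonempty X := by
  by_contra h
  rw [not_nonempty_iff] at h
  obtain ⟨r, -, -⟩ := hX.exists_retraction PUnit (fun _ => PUnit.unit)
    (.of_continuous_injective_isClosedMap (continuous_of_const fun x => isEmptyElim x)
      (fun x => isEmptyElim x) fun _ _ => isClosed_discrete _)
  exact isEmptyElim (r PUnit.unit)

/-- A proper metric space is closed in `ℝ^ℕ`, by the distances to the points of a dense sequence. -/
theorem isClosedEmbedding_dist_denseSeq (X : Type u) [MetricSpace X] [ProperSpace X] [Nonempty X] :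
    IsClosedEmbedding fun (x : X) (n : ℕ) => dist x (TopologicalSpace.denseSeq X n) := by
  have hcont : Continuous fun (x : X) (n : ℕ) => dist x (TopologicalSpace.denseSeq X n) := by
    fun_prop
  refine .of_continuous_injective_isClosedMap hcont (fun x y hxy => ?_) ?_
  · refine dist_le_zero.1 (le_of_forall_pos_le_add fun ε hε => ?_)
    obtain ⟨n, hn⟩ := (TopologicalSpace.denseRange_denseSeq X).exists_dist_lt x (half_pos hε)
    have h1 := congrFun hxy n
    have h2 := dist_triangle_right x y (TopologicalSpace.denseSeq X n)
    linarith
  · refine (isProperMap_iff_isCompact_preimage.2 ⟨hcont, fun K hK => ?_⟩).isClosedMap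
    -- Coordinate `0` is the distance to a single point, so bounding it already confines the
    -- preimage to a compact ball.
    obtain ⟨b, hb⟩ := (hK.image (continuous_apply 0)).bddAbove
    refine (isCompact_closedBall (TopologicalSpace.denseSeq X 0) b).of_isClosed_subset
      (hK.isClosed.preimage hcont) fun x hx => ?_
    exact hb ⟨_, hx, rfl⟩

/-- Maps from closed subsets of normal spaces into a compact subset of a proper absolute retract
extend, with values in a compact set that depends only on the given one. -/
theorem IsAR.exists_compact_extension {Y : Type u} [MetricSpace Y] [ProperSpace Y] (hY : IsAR Y)
    {K : Set Y} (hK : IsCompact K) :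
    ∃ K' : Set Y, IsCompact K' ∧ ∀ (X : Type v) [TopologicalSpace X] [NormalSpace X] (C : Set X)
      (g : X → Y), IsClosed C → ContinuousOn g C → MapsTo g C K →
        ∃ f : C(X, Y), EqOn f g C ∧ ∀ x, f x ∈ K' := by
  have := hY.nonempty
  -- `IsAR` tests only spaces in the universe of `Y`, so `ℝ^ℕ` is lifted there.
  have hφ := Homeomorph.ulift.{u}.symm.isClosedEmbedding.comp (isClosedEmbedding_dist_denseSeq Y)
  have : TopologicalSpace.MetrizableSpace (ULift.{u} (ℕ → ℝ)) :=
    Homeomorph.ulift.isEmbedding.metrizableSpace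
  have : TopologicalSpace.SeparableSpace (ULift.{u} (ℕ → ℝ)) :=
    Homeomorph.ulift.{u}.symm.surjective.denseRange.separableSpace
      Homeomorph.ulift.{u}.symm.continuous
  obtain ⟨r, hr, hre⟩ := hY.exists_retraction _ _ hφ
  have hbound : ∀ n, ∃ b, 0 ≤ b ∧ ∀ y ∈ K, dist y (TopologicalSpace.denseSeq Y n) ≤ b := by
    intro n
    obtain ⟨b, hb⟩ := (hK.image
      (continuous_id.dist (continuous_const (y := TopologicalSpace.denseSeq Y n)))).bddAbove
    exact ⟨max b 0, le_max_right _ _, fun y hy => (hb ⟨y, hy, rfl⟩).trans (le_max_left _ _)⟩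
  choose b hb0 hb using hbound
  have hρ : Continuous fun z : ℕ → ℝ => r (ULift.up z) :=
    hr.comp Homeomorph.ulift.{u}.symm.continuous
  -- `K'` is the retracted image of a compact box containing the embedded `K`. Tietze's theorem in
  -- each coordinate extends maps without leaving the box.
  refine ⟨_, (isCompact_univ_pi fun n => isCompact_Icc (a := 0) (b := b n)).image hρ,
    fun X _ _ C g hC hg hgK => ?_⟩
  have hext : ∀ n, ∃ F : C(X, ℝ), (∀ x, F x ∈ Icc 0 (b n)) ∧
      ∀ x ∈ C, F x = dist (g x) (TopologicalSpace.denseSeq Y n) := by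
    intro n
    obtain ⟨F, hF, hFg⟩ := ContinuousMap.exists_restrict_eq_forall_mem_of_closed (s := C)
      ⟨fun x => dist (g x) (TopologicalSpace.denseSeq Y n),
        (continuousOn_iff_continuous_domRestrict.1 hg).dist continuous_const⟩
      (t := Icc 0 (b n)) (fun x => ⟨dist_nonneg, hb n _ (hgK x.2)⟩)
      (nonempty_Icc.2 (hb0 n)) hC
    exact ⟨F, hF, fun x hx => DFunLike.congr_fun hFg ⟨x, hx⟩⟩
  choose F hF hFg using hext
  refine ⟨⟨fun x => r (ULift.up fun n => F n x), hρ.comp (by fun_prop)⟩, fun x hx => ?_,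
    fun x => ⟨fun n => F n x, fun n _ => hF n x, rfl⟩⟩
  rw [← hre (g x)]
  exact congrArg (fun z => r (ULift.up z)) (funext fun n => hFg n x hx)

/-- Maps from closed subsets of normal spaces into balls of `Y` extend with values in a concentric
ball whose radius depends only on the radius of the given one. -/
def HasUniformExtension (Y : Type u) [MetricSpace Y] : Prop :=
  ∀ R : ℝ, ∃ S : ℝ, ∀ (X : Type v) [TopologicalSpace X] [NormalSpace X] (C : Set X)
    (g : X → Y) (y : Y), IsClosed C → ContinuousOn g C → (∀ x ∈ C, dist (g x) y ≤ R) →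
      ∃ f : C(X, Y), EqOn f g C ∧ ∀ x, dist (f x) y ≤ S

/-- Cocompactness makes the radius independent of the center: an isometry from `H` moves the center
into `K` and the map into the compact `R`-thickening of `K`, where one `K'` serves all maps. The
extension is then moved back. -/
theorem IsAR.hasUniformExtension {H : Type*} [Group H] {Y : Type u} [MetricSpace Y] [ProperSpace Y]
    (hY : IsAR Y) [MulAction H Y] (hHY : IsGeometricAction H Y) :
    HasUniformExtension.{u, v} Y := by
  intro R
  obtain ⟨K, hK, hKY⟩ := hHY.cocompact
  have : IsIsometricSMul H Y := ⟨fun h => Isometry.of_dist_eq (hHY.isometry h)⟩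
  obtain ⟨K', hK', hext⟩ := hY.exists_compact_extension.{u, v} (hK.cthickening (r := R))
  obtain ⟨S, hS⟩ := Metric.isBounded_iff.1 (hK.union hK').isBounded
  refine ⟨S, fun X _ _ C g y hC hg hgy => ?_⟩
  obtain ⟨h, k, hk, rfl⟩ := hKY y
  obtain ⟨f, hfg, hfK⟩ := hext X C (fun x => h⁻¹ • g x) hC (hg.const_smul _) fun x hx => by
    refine Metric.mem_cthickening_of_dist_le _ k _ _ hk ?_
    rw [← hHY.isometry h, smul_inv_smul]
    exact hgy x hx
  refine ⟨⟨fun x => h • f x, by fun_prop⟩, fun x hx => ?_, fun x => ?_⟩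
  · simp [hfg hx]
  · simpa [hHY.isometry] using hS (Or.inr (hfK x)) (Or.inl hk)

/-! ### Continuous approximation -/

/-- One step of the approximation: extending over a locally finite family of disjoint closed
sets. -/
theorem HasUniformExtension.exists_extend_disjoint {Y : Type u} [MetricSpace Y]
    (hY : HasUniformExtension.{u, v} Y) {X : Type v} [TopologicalSpace X] [NormalSpace X]
    {A : Set X} (hA : IsClosed A) {ψ : X → Y} (hψ : ContinuousOn ψ A) {ι : Type*} {U : ι → Set X}
    (hU : ∀ i, IsClosed (U i)) (hfin : LocallyFinite U)
    (hdisj : Pairwise (Function.onFun Disjoint U)) {R : ℝ}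
    (hR : ∀ i, ∀ x ∈ U i, ∀ x' ∈ U i, dist (ψ x) (ψ x') ≤ R) :
    ∃ f : X → Y, EqOn f ψ A ∧ ContinuousOn f (A ∪ ⋃ i, U i) ∧ BoundedlyClose f ψ := by
  classical
  obtain ⟨S, hS⟩ := hY R
  have hext : ∀ i, ∃ f : X → Y, ContinuousOn f (U i) ∧ EqOn f ψ (A ∩ U i) ∧
      ∀ x ∈ U i, dist (f x) (ψ x) ≤ S + R := by
    intro i
    rcases (U i).eq_empty_or_nonempty with h | ⟨x₀, hx₀⟩
    · exact ⟨ψ, by simp [h]⟩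
    · obtain ⟨f, hf, hfS⟩ := hS X (A ∩ U i) ψ (ψ x₀) (hA.inter (hU i))
        (hψ.mono inter_subset_left) fun x hx => hR i x hx.2 x₀ hx₀
      exact ⟨f, f.continuous.continuousOn, hf, fun x hx => (dist_triangle _ (ψ x₀) _).trans
        (add_le_add (hfS x) (hR i x₀ hx₀ x hx))⟩
  choose F hFc hFA hFd using hext
  let f : X → Y := fun x => if h : ∃ i, x ∈ U i then F h.choose x else ψ x
  have hfU : ∀ i, EqOn f (F i) (U i) := by
    intro i x hx
    have h : ∃ i, x ∈ U i := ⟨i, hx⟩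
    have hi : h.choose = i := by
      by_contra hne
      exact disjoint_left.1 (hdisj hne) h.choose_spec hx
    simp only [f, dif_pos h, hi]
  have hfA : EqOn f ψ A := by
    intro x hx
    by_cases h : ∃ i, x ∈ U i
    · obtain ⟨i, hi⟩ := h
      rw [hfU i hi, hFA i ⟨hx, hi⟩]
    · simp only [f, dif_neg h]
  refine ⟨f, hfA, ?_, max (S + R) 0, fun x => ?_⟩
  · exact (hψ.congr hfA).union_of_isClosed
      (hfin.continuousOn_iUnion hU fun i => (hFc i).congr (hfU i)) hA (hfin.isClosed_iUnion hU)
  · by_cases h : ∃ i, x ∈ U i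
    · obtain ⟨i, hi⟩ := h
      rw [hfU i hi]
      exact (hFd i x hi).trans (le_max_left _ _)
    · simp only [f, dif_neg h, dist_self, le_max_right]

theorem BoundedlyClose.trans {X Y : Type*} [MetricSpace Y] {f g h : X → Y}
    (hfg : BoundedlyClose f g) (hgh : BoundedlyClose g h) : BoundedlyClose f h := by
  obtain ⟨K, hK⟩ := hfg
  obtain ⟨L, hL⟩ := hgh
  exact ⟨K + L, fun x => (dist_triangle _ _ _).trans (add_le_add (hK x) (hL x))⟩

/-- A function into `Y` that has bounded oscillation on the members of a locally finite, finitely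
colored closed cover, and is continuous on a closed set `A`, is boundedly close to a continuous map
that agrees with it on `A`. -/
theorem HasUniformExtension.exists_continuous_boundedlyClose {Y : Type u} [MetricSpace Y]
    (hY : HasUniformExtension.{u, v} Y) {X : Type v} [TopologicalSpace X] [NormalSpace X]
    {A : Set X} (hA : IsClosed A) {ψ : X → Y} (hψ : ContinuousOn ψ A) {ι : Type*} {U : ι → Set X}
    (hU : ∀ i, IsClosed (U i)) (hfin : LocallyFinite U) (hcover : ⋃ i, U i = univ)
    {c : ι → ℕ} {N : ℕ} (hcN : ∀ i, c i < N)
    (hc : ∀ i j, i ≠ j → c i = c j → Disjoint (U i) (U j)) {R : ℝ}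
    (hR : ∀ i, ∀ x ∈ U i, ∀ x' ∈ U i, dist (ψ x) (ψ x') ≤ R) :
    ∃ f : C(X, Y), EqOn f ψ A ∧ BoundedlyClose f ψ := by
  have key : ∀ n : ℕ, ∃ f : X → Y, EqOn f ψ A ∧
      ContinuousOn f (A ∪ ⋃ i : {i // c i < n}, U i) ∧ BoundedlyClose f ψ := by
    intro n
    induction n with
    | zero => exact ⟨ψ, eqOn_refl _ _, by
        have : IsEmpty {i // c i < 0} := ⟨fun i => Nat.not_lt_zero _ i.2⟩
        simpa only [iUnion_of_empty, union_empty] using hψ, 0, fun x => (dist_self _).le⟩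
    | succ n ih =>
      obtain ⟨f, hfA, hfc, D, hD⟩ := ih
      have hsub (p : ι → Prop) : LocallyFinite fun i : {i // p i} => U i :=
        hfin.comp_injective Subtype.val_injective
      obtain ⟨f', hf', hfc', hD'⟩ := hY.exists_extend_disjoint
        (hA.union ((hsub (c · < n)).isClosed_iUnion fun i => hU i)) hfc
        (U := fun i : {i // c i = n} => U i) (fun i => hU i) (hsub _)
        (fun i j hij => hc i j (Subtype.coe_injective.ne hij) (i.2.trans j.2.symm))
        -- The current `f` is within `D` of `ψ`, so its oscillation on each `U i` exceeds that of
        -- `ψ` by at most `2D`.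
        (R := D + R + D) fun i x hx x' hx' => by
          have h1 := dist_triangle4 (f x) (ψ x) (ψ x') (f x')
          have h2 := hD x
          have h3 := hD x'
          rw [dist_comm] at h3
          have h4 := hR i x hx x' hx'
          linarith
      refine ⟨f', (hf'.mono subset_union_left).trans hfA, hfc'.mono ?_, hD'.trans ⟨D, hD⟩⟩
      rintro x (hx | hx)
      · exact Or.inl (Or.inl hx)
      · obtain ⟨⟨i, hi⟩, hx⟩ := mem_iUnion.1 hx
        rcases Nat.lt_succ_iff_lt_or_eq.1 hi with hi | hi
        · exact Or.inl (Or.inr (mem_iUnion.2 ⟨⟨i, hi⟩, hx⟩))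
        · exact Or.inr (mem_iUnion.2 ⟨⟨i, hi⟩, hx⟩)
  obtain ⟨f, hfA, hfc, hD⟩ := key N
  refine ⟨⟨f, continuousOn_univ.1 (hfc.mono fun x _ => Or.inr ?_)⟩, hfA, hD⟩
  obtain ⟨i, hi⟩ := mem_iUnion.1 (hcover.symm ▸ mem_univ x : x ∈ ⋃ i, U i)
  exact mem_iUnion.2 ⟨⟨i, hcN i⟩, hi⟩

/-- Greedy coloring: a symmetric relation of bounded valency has a proper finite coloring. -/
theorem exists_finite_coloring {ι : Type*} (r : ι → ι → Prop) (hr : ∀ i j, r i j → r j i) {N : ℕ}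
    (hN : ∀ i, {j | r i j}.encard < N) :
    ∃ c : ι → ℕ, (∀ i, c i < N) ∧ ∀ i j, i ≠ j → c i = c j → ¬ r i j := by
  have hwf : WellFounded (WellOrderingRel (α := ι)) := WellOrderingRel.isWellOrder.wf
  -- Each index takes the least color not used by its earlier neighbors. With fewer than `N`
  -- neighbors, some color below `N` is free.
  let c : ι → ℕ := hwf.fix fun i c =>
    sInf {n | ∀ j (h : WellOrderingRel j i), r i j → c j h ≠ n}
  have hc : ∀ i, c i = sInf {n | ∀ j, WellOrderingRel j i → r i j → c j ≠ n} := fun i =>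
    hwf.fix_eq _ i
  have hex : ∀ i, ∃ n < N, ∀ j, WellOrderingRel j i → r i j → c j ≠ n := by
    intro i
    by_contra! h
    have hsub : (Finset.range N : Set ℕ) ⊆ c '' {j | r i j} := by
      intro n hn
      obtain ⟨j, -, hj, rfl⟩ := h n (by simpa using hn)
      exact ⟨j, hj, rfl⟩
    have h1 := (encard_le_encard hsub).trans (encard_image_le _ _)
    rw [encard_coe_eq_coe_finsetCard, Finset.card_range] at h1
    exact absurd (hN i) h1.not_gt
  refine ⟨c, fun i => ?_, ?_⟩
  · obtain ⟨n, hn, h⟩ := hex i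
    rw [hc]
    exact lt_of_le_of_lt (Nat.sInf_le (by exact h)) hn
  · have hlt : ∀ i j, WellOrderingRel j i → c i = c j → ¬ r i j := by
      intro i j hji hij hrij
      obtain ⟨n, -, h⟩ := hex i
      have := Nat.sInf_mem (s := {n | ∀ j, WellOrderingRel j i → r i j → c j ≠ n}) ⟨n, h⟩
      rw [← hc] at this
      exact this j hji hrij hij.symm
    intro i j hij hcij hrij
    rcases trichotomous_of WellOrderingRel i j with h | h | h
    · exact hlt j i h hcij.symm (hr _ _ hrij)
    · exact hij h
    · exact hlt i j h hcij hrij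

/-! ### The cover by translates of a compact set -/

/-- Properness of the action is used twice: on `K` it bounds the number of translates meeting a
given one, hence the number of colors; on `K` enlarged by a unit ball it gives local finiteness. -/
theorem IsGeometricAction.exists_cover {G : Type*} [Group G] {X : Type*} [MetricSpace X]
    [ProperSpace X] [MulAction G X] (h : IsGeometricAction G X) :
    ∃ (U : G → Set X) (c : G → ℕ) (N : ℕ) (D : ℝ), (∀ g, IsClosed (U g)) ∧ LocallyFinite U ∧
      ⋃ g, U g = univ ∧ (∀ g, c g < N) ∧ (∀ g g', g ≠ g' → c g = c g' → Disjoint (U g) (U g')) ∧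
      ∀ g, ∀ x ∈ U g, ∀ x' ∈ U g, dist x x' ≤ D := by
  obtain ⟨K, hK, hKX⟩ := h.cocompact
  have : IsIsometricSMul G X := ⟨fun g => Isometry.of_dist_eq (h.isometry g)⟩
  obtain ⟨D, hD⟩ := Metric.isBounded_iff.1 hK.isBounded
  have hfin := h.proper K hK
  set F := {g : G | (((g • ·) '' K) ∩ K).Nonempty} with hF
  obtain ⟨c, hcN, hc⟩ := exists_finite_coloring
    (fun g g' : G => (((g • ·) '' K) ∩ ((g' • ·) '' K)).Nonempty)
    (fun g g' hg => by rwa [inter_comm]) (N := F.ncard + 1) (fun g => by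
      have hsub : {g' : G | (((g • ·) '' K) ∩ ((g' • ·) '' K)).Nonempty} ⊆ (g * ·) '' F := by
        rintro g' ⟨-, ⟨k, hk, rfl⟩, k', hk', hkk⟩
        refine ⟨g⁻¹ * g', ⟨k, ⟨k', hk', ?_⟩, hk⟩, by simp⟩
        simp only at hkk
        simp [mul_smul, hkk]
      refine ((encard_le_encard hsub).trans (encard_image_le _ _)).trans_lt ?_
      rw [← hfin.cast_ncard_eq]
      exact_mod_cast Nat.lt_succ_self _)
  refine ⟨fun g => (g • ·) '' K, c, F.ncard + 1, D, fun g =>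
    (hK.image (continuous_const_smul g)).isClosed, fun x => ?_, ?_, hcN, fun g g' hg hcg => ?_, ?_⟩
  · refine ⟨_, Metric.closedBall_mem_nhds x one_pos,
      (h.proper _ (hK.union (isCompact_closedBall x 1))).subset ?_⟩
    exact fun g hg => hg.mono (inter_subset_inter (image_mono subset_union_left)
      subset_union_right)
  · refine eq_univ_of_forall fun x => ?_
    obtain ⟨g, k, hk, hx⟩ := hKX x
    exact mem_iUnion.2 ⟨g, k, hk, hx⟩
  · exact disjoint_iff_inter_eq_empty.2 (not_nonempty_iff_eq_empty.1 (hc g g' hg hcg))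
  · rintro g _ ⟨k, hk, rfl⟩ _ ⟨k', hk', rfl⟩
    simpa [h.isometry] using hD hk hk'

/-- Large-scale uniform functions are boundedly close to continuous ones. -/
theorem LargeScaleUniform.exists_continuous_boundedlyClose {G : Type*} [Group G] {X : Type v}
    {Y : Type u} [MetricSpace X] [ProperSpace X] [MulAction G X] (hX : IsGeometricAction G X)
    [MetricSpace Y] (hY : HasUniformExtension.{u, v} Y) {φ : X → Y} (hφ : LargeScaleUniform φ) :
    ∃ f : C(X, Y), BoundedlyClose f φ := by
  obtain ⟨U, c, N, D, hU, hfin, hcover, hcN, hc, hD⟩ := hX.exists_cover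
  obtain ⟨S, -, hS⟩ := hφ (max D 0 + 1) (by positivity)
  obtain ⟨f, -, hf⟩ := hY.exists_continuous_boundedlyClose isClosed_empty (continuousOn_empty φ)
    hU hfin hcover hcN hc (R := S) fun g x hx x' hx' => (hS x x' (by
      linarith [hD g x hx x' hx', le_max_left D 0])).le
  exact ⟨f, hf⟩

/-- Boundedly close continuous large-scale uniform maps are boundedly homotopic. -/
theorem LargeScaleUniform.exists_isBoundedHomotopy {G : Type*} [Group G] {X : Type v}
    {Y : Type u} [MetricSpace X] [ProperSpace X] [MulAction G X] (hX : IsGeometricAction G X)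
    [MetricSpace Y] (hY : HasUniformExtension.{u, v} Y) {f₀ f₁ : C(X, Y)}
    (hf : LargeScaleUniform f₁) (hff : BoundedlyClose f₀ f₁) :
    ∃ F : f₀.Homotopy f₁, IsBoundedHomotopy F := by
  classical
  obtain ⟨U, c, N, D, hU, hfin, hcover, hcN, hc, hD⟩ := hX.exists_cover
  obtain ⟨S, -, hS⟩ := hf (max D 0 + 1) (by positivity)
  obtain ⟨K, hK⟩ := hff
  -- Continuity is needed only on the two ends; in between, any function at bounded distance from
  -- `f₁` would do.
  let ψ : unitInterval × X → Y := fun p => if p.1 = 0 then f₀ p.2 else f₁ p.2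
  have hψd : ∀ p, dist (ψ p) (f₁ p.2) ≤ max K 0 := by
    intro p
    by_cases hp : p.1 = 0
    · simpa only [ψ, if_pos hp] using (hK p.2).trans (le_max_left _ _)
    · simp [ψ, if_neg hp]
  have h0 : IsClosed {p : unitInterval × X | p.1 = 0} := isClosed_eq continuous_fst continuous_const
  have h1 : IsClosed {p : unitInterval × X | p.1 = 1} := isClosed_eq continuous_fst continuous_const
  have hψ : ContinuousOn ψ ({p | p.1 = 0} ∪ {p | p.1 = 1}) := by
    refine ContinuousOn.union_of_isClosed ?_ ?_ h0 h1
    · exact (f₀.continuous.comp continuous_snd).continuousOn.congr fun p hp => if_pos hp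
    · refine (f₁.continuous.comp continuous_snd).continuousOn.congr fun p hp => if_neg ?_
      rw [mem_ofPred_eq] at hp
      simp [hp]
  obtain ⟨F, hFψ, L, hL⟩ := hY.exists_continuous_boundedlyClose (h0.union h1) hψ
    (U := fun g => Prod.snd ⁻¹' U g) (fun g => (hU g).preimage continuous_snd)
    (hfin.preimage_continuous continuous_snd) (by rw [← preimage_iUnion, hcover, preimage_univ])
    hcN (fun g g' hg hcg => (hc g g' hg hcg).preimage _) (R := max K 0 + S + max K 0)
    fun g p hp p' hp' => by
      have h1 := dist_triangle4 (ψ p) (f₁ p.2) (f₁ p'.2) (ψ p')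
      have h2 := hψd p
      have h3 := hψd p'
      rw [dist_comm] at h3
      have h4 := hS p.2 p'.2 (by linarith [hD g _ hp _ hp', le_max_left D 0])
      linarith
  have hF0 : ∀ x, F (0, x) = f₀ x := fun x => (hFψ (Or.inl rfl)).trans (if_pos rfl)
  have hF1 : ∀ x, F (1, x) = f₁ x := fun x => (hFψ (Or.inr rfl)).trans (if_neg (by simp))
  have hFf : ∀ p, dist (F p) (f₁ p.2) ≤ L + max K 0 := fun p =>
    (dist_triangle _ (ψ p) _).trans (add_le_add (hL p) (hψd p))
  exact ⟨⟨F, hF0, hF1⟩, (L + max K 0) + (L + max K 0), fun x s t =>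
    (dist_triangle_right _ _ (f₁ x)).trans (add_le_add (hFf (s, x)) (hFf (t, x)))⟩

/-- A bounded homotopy to the identity of a proper metric space is proper. -/
theorem IsBoundedHomotopy.isProperMap {X : Type*} [MetricSpace X] [ProperSpace X] {f : C(X, X)}
    {F : f.Homotopy (ContinuousMap.id X)} (hF : IsBoundedHomotopy F) : IsProperMap F := by
  obtain ⟨K, hK⟩ := hF
  refine isProperMap_iff_isCompact_preimage.2 ⟨F.continuous, fun C hC => ?_⟩
  refine (isCompact_univ.prod (hC.cthickening (r := K))).of_isClosed_subset
    (hC.isClosed.preimage F.continuous) fun p hp => ⟨mem_univ _, ?_⟩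
  -- The track of `x` ends at `x`, so a track meeting `C` starts from a point `x` within `K` of `C`.
  refine Metric.mem_cthickening_of_dist_le _ (F p) _ _ hp ?_
  simpa using hK p.2 1 p.1

/-! ### Coarse inverses -/

theorem LargeScaleUniform.comp {X Y Z : Type*} [MetricSpace X] [MetricSpace Y] [MetricSpace Z]
    {g : Y → Z} {f : X → Y} (hg : LargeScaleUniform g) (hf : LargeScaleUniform f) :
    LargeScaleUniform (g ∘ f) := fun R hR =>
  have ⟨S, hS, hfS⟩ := hf R hR
  have ⟨T, hT, hgT⟩ := hg S hS
  ⟨T, hT, fun _ _ h => hgT _ _ (hfS _ _ h)⟩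

theorem largeScaleUniform_id {X : Type*} [MetricSpace X] : LargeScaleUniform (id : X → X) :=
  fun R hR => ⟨R, hR, fun _ _ h => h⟩

theorem LargeScaleUniform.comp_boundedlyClose {X Y Z : Type*} [MetricSpace Y] [MetricSpace Z]
    {g : Y → Z} (hg : LargeScaleUniform g) {f f' : X → Y} (h : BoundedlyClose f f') :
    BoundedlyClose (g ∘ f) (g ∘ f') := by
  obtain ⟨K, hK⟩ := h
  obtain ⟨S, -, hS⟩ := hg (max K 0 + 1) (by positivity)
  exact ⟨S, fun x => (hS _ _ (by linarith [hK x, le_max_left K 0])).le⟩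

theorem BoundedlyClose.comp_right {X Y Z : Type*} [MetricSpace Z] {g g' : Y → Z}
    (h : BoundedlyClose g g') (f : X → Y) : BoundedlyClose (g ∘ f) (g' ∘ f) :=
  h.imp fun _ hK x => hK (f x)

theorem LargeScaleUniform.of_boundedlyClose {X Y : Type*} [MetricSpace X] [MetricSpace Y]
    {f f' : X → Y} (hf : LargeScaleUniform f) (h : BoundedlyClose f' f) : LargeScaleUniform f' := by
  obtain ⟨K, hK⟩ := h
  intro R hR
  obtain ⟨S, hS, hfS⟩ := hf R hR
  refine ⟨max K 0 + S + max K 0, by positivity, fun x x' hx => ?_⟩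
  have h1 := dist_triangle4 (f' x) (f x) (f x') (f' x')
  have h2 := hK x
  have h3 := hK x'
  rw [dist_comm] at h3
  have h4 := hfS x x' hx
  have h5 := le_max_left K 0
  linarith

/-- `f` and `g` are large-scale uniform functions that are inverse to each other up to bounded
distance. -/
structure AreCoarseInverses {X Y : Type*} [MetricSpace X] [MetricSpace Y] (f : X → Y) (g : Y → X) :
    Prop where
  left_uniform : LargeScaleUniform f
  right_uniform : LargeScaleUniform g
  right_left : BoundedlyClose (g ∘ f) id
  left_right : BoundedlyClose (f ∘ g) id

namespace AreCoarseInverses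

variable {X Y Z : Type*} [MetricSpace X] [MetricSpace Y] [MetricSpace Z] {f : X → Y} {g : Y → X}

theorem symm (h : AreCoarseInverses f g) : AreCoarseInverses g f :=
  ⟨h.right_uniform, h.left_uniform, h.left_right, h.right_left⟩

theorem comp (h : AreCoarseInverses f g) {f' : Y → Z} {g' : Z → Y} (h' : AreCoarseInverses f' g') :
    AreCoarseInverses (f' ∘ f) (g ∘ g') where
  left_uniform := h'.left_uniform.comp h.left_uniform
  right_uniform := h.right_uniform.comp h'.right_uniform
  right_left := (h.right_uniform.comp_boundedlyClose (h'.right_left.comp_right f)).trans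
    h.right_left
  left_right := (h'.left_uniform.comp_boundedlyClose (h.left_right.comp_right g')).trans
    h'.left_right

theorem of_boundedlyClose (h : AreCoarseInverses f g) {f' : X → Y} {g' : Y → X}
    (hf : BoundedlyClose f' f) (hg : BoundedlyClose g' g) : AreCoarseInverses f' g' where
  left_uniform := h.left_uniform.of_boundedlyClose hf
  right_uniform := h.right_uniform.of_boundedlyClose hg
  right_left := ((hg.comp_right f').trans (h.right_uniform.comp_boundedlyClose hf)).trans
    h.right_left
  left_right := ((hf.comp_right g').trans (h.left_uniform.comp_boundedlyClose hg)).trans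
    h.left_right

/-- Metric properness comes from the inverse: `g` maps bounded sets to bounded sets, and `g ∘ f`
moves points a bounded amount. -/
theorem isCoarse (h : AreCoarseInverses f g) : IsCoarse f := by
  refine ⟨fun B hB => ?_, h.left_uniform⟩
  obtain ⟨R, hR⟩ := Metric.isBounded_iff.1 hB
  obtain ⟨S, -, hS⟩ := h.right_uniform (max R 0 + 1) (by positivity)
  obtain ⟨K, hK⟩ := h.right_left
  refine Metric.isBounded_iff.2 ⟨K + S + K, fun x hx x' hx' => ?_⟩
  have h1 := dist_triangle4 x (g (f x)) (g (f x')) x'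
  have h2 := hK x
  have h3 := hK x'
  rw [dist_comm] at h2
  have h4 := hS (f x) (f x') (by linarith [hR hx hx', le_max_left R 0])
  simp only [Function.comp_apply, id_eq] at h2 h3
  linarith

theorem isCoarseEquivalence (h : AreCoarseInverses f g) : IsCoarseEquivalence f :=
  ⟨h.isCoarse, g, h.symm.isCoarse, h.right_left, h.left_right⟩

end AreCoarseInverses

/-! ### Word metrics -/

section WordMetric

variable {G : Type*} [Group G] {S : Set G}

theorem wordLength_le {l : List G} (hl : ∀ s ∈ l, s ∈ S ∨ s⁻¹ ∈ S) :
    wordLength S l.prod ≤ l.length :=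
  Nat.sInf_le ⟨l, hl, rfl, rfl⟩

theorem exists_word (hS : Subgroup.closure S = ⊤) (g : G) :
    ∃ l : List G, (∀ s ∈ l, s ∈ S ∨ s⁻¹ ∈ S) ∧ l.prod = g ∧ l.length = wordLength S g := by
  have hg : g ∈ (Subgroup.closure S).toSubmonoid := hS ▸ Subgroup.mem_top g
  rw [Subgroup.closure_toSubmonoid] at hg
  obtain ⟨l, hl, hg⟩ := Submonoid.exists_list_of_mem_closure hg
  exact Nat.sInf_mem (s := {n : ℕ | ∃ l : List G, (∀ s ∈ l, s ∈ S ∨ s⁻¹ ∈ S) ∧ l.prod = g ∧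
    l.length = n}) ⟨_, l, hl, hg, rfl⟩

theorem wordLength_one : wordLength S 1 = 0 :=
  Nat.le_zero.1 (wordLength_le (S := S) (l := []) (by simp))

theorem wordLength_mul_le (hS : Subgroup.closure S = ⊤) (g h : G) :
    wordLength S (g * h) ≤ wordLength S g + wordLength S h := by
  obtain ⟨l, hl, hlg, hln⟩ := exists_word hS g
  obtain ⟨m, hm, hmh, hmn⟩ := exists_word hS h
  rw [← hln, ← hmn, ← hlg, ← hmh, ← List.prod_append, ← List.length_append]
  exact wordLength_le fun s hs => (List.mem_append.1 hs).elim (hl s) (hm s)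

theorem wordLength_inv_le (hS : Subgroup.closure S = ⊤) (g : G) :
    wordLength S g⁻¹ ≤ wordLength S g := by
  obtain ⟨l, hl, hlg, hln⟩ := exists_word hS g
  rw [← hln, ← hlg, List.prod_inv_reverse]
  refine (wordLength_le fun s hs => ?_).trans (by simp)
  obtain ⟨t, ht, rfl⟩ := List.mem_map.1 (List.mem_reverse.1 hs)
  simpa [or_comm] using hl t ht

/-- The word metric of a generating set, as a metric space structure. -/
noncomputable abbrev wordMetricSpace (hS : Subgroup.closure S = ⊤) : MetricSpace G where
  dist := wordDist S
  dist_self g := by simp [wordDist, wordLength_one]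
  dist_comm g h := by
    have key : ∀ g h : G, wordDist S g h ≤ wordDist S h g := fun g h => by
      simpa [wordDist] using wordLength_inv_le hS (h⁻¹ * g)
    exact (key g h).antisymm (key h g)
  dist_triangle g h k := by
    have := wordLength_mul_le hS (g⁻¹ * h) (h⁻¹ * k)
    rw [mul_assoc, mul_inv_cancel_left] at this
    simpa only [wordDist] using mod_cast this
  eq_of_dist_eq_zero {g h} hgh := by
    obtain ⟨l, -, hl, hln⟩ := exists_word hS (g⁻¹ * h)
    have h0 : wordLength S (g⁻¹ * h) = 0 := Nat.cast_eq_zero.1 hgh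
    rw [h0, List.length_eq_zero_iff] at hln
    rw [hln, List.prod_nil] at hl
    exact (inv_mul_eq_one.1 hl.symm)

/-- A geometric action makes the group, with a word metric, coarsely equivalent to the space. -/
theorem IsGeometricAction.exists_areCoarseInverses (hfin : S.Finite) (hS : Subgroup.closure S = ⊤)
    {X : Type*} [MetricSpace X] [ProperSpace X] [Nonempty X] [MulAction G X]
    (h : IsGeometricAction G X) :
    let := wordMetricSpace hS
    ∃ (α : X → G) (β : G → X), AreCoarseInverses α β := by
  let := wordMetricSpace hS
  have hdist : ∀ g g' : G, dist g g' = wordLength S (g⁻¹ * g') := fun _ _ => rfl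
  obtain ⟨K, hK, hKX⟩ := h.cocompact
  choose α k hk hα using hKX
  obtain ⟨x₀⟩ := ‹Nonempty X›
  -- Such a `g` moves a compact thickening of `K ∪ {x₀}` to meet itself, so only finitely many
  -- occur. The base point is adjoined because it need not lie in `K`.
  have hbound : ∀ R : ℝ, ∃ n : ℝ, 0 < n ∧ ∀ g : G, ∀ x ∈ K ∪ {x₀}, ∀ x' ∈ K ∪ {x₀},
      dist x (g • x') ≤ R → wordLength S g < n := by
    intro R
    have hC : IsCompact (Metric.cthickening (max R 0) (K ∪ {x₀})) :=
      (hK.union isCompact_singleton).cthickening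
    obtain ⟨n, hn⟩ := ((h.proper _ hC).image (wordLength S)).bddAbove
    refine ⟨n + 1, by positivity, fun g x hx x' hx' hd => ?_⟩
    refine Nat.cast_lt.2 (Nat.lt_succ_of_le (hn ⟨g, ⟨g • x', ⟨x', Metric.self_subset_cthickening _ hx', rfl⟩,
      Metric.mem_cthickening_of_dist_le _ x _ _ hx ?_⟩, rfl⟩)) |>.trans_eq
      (Nat.cast_succ n)
    rw [dist_comm]
    exact hd.trans (le_max_left _ _)
  have hαk : ∀ (x : X) (g : G) (y : X), dist (k x) (((α x)⁻¹ * g) • y) = dist x (g • y) := by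
    intro x g y
    rw [← h.isometry (α x), hα, smul_smul, mul_inv_cancel_left]
  obtain ⟨M, hM⟩ := (hfin.image fun s => dist (s • x₀) x₀).bddAbove
  -- Each letter displaces `x₀` by at most `max M 0`, so the orbit map is Lipschitz for the word
  -- metric.
  have hprod : ∀ l : List G, (∀ s ∈ l, s ∈ S ∨ s⁻¹ ∈ S) →
      dist (l.prod • x₀) x₀ ≤ l.length * max M 0 := by
    intro l hl
    induction l with
    | nil => simp
    | cons s l ih =>
      have h1 := ih fun t ht => hl t (List.mem_cons_of_mem _ ht)
      have h2 : dist (s • x₀) x₀ ≤ max M 0 := by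
        refine le_trans ?_ (le_max_left _ _)
        rcases hl s List.mem_cons_self with hs | hs
        · exact hM ⟨s, hs, rfl⟩
        · rw [← h.isometry s⁻¹, inv_smul_smul, dist_comm]
          exact hM ⟨_, hs, rfl⟩
      have h3 := dist_triangle (s • l.prod • x₀) (s • x₀) x₀
      rw [h.isometry] at h3
      rw [List.prod_cons, mul_smul, List.length_cons]
      push_cast
      linarith
  have hclose : BoundedlyClose ((fun g : G => g • x₀) ∘ α) id := by
    obtain ⟨D, hD⟩ := Metric.isBounded_iff.1 (hK.union (isCompact_singleton (x := x₀))).isBounded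
    refine ⟨D, fun x => ?_⟩
    rw [Function.comp_apply, id, dist_comm, ← hαk, inv_mul_cancel, one_smul]
    exact hD (Or.inl (hk x)) (Or.inr rfl)
  refine ⟨α, fun g => g • x₀, fun R hR => ?_, fun R hR => ?_, hclose, ?_⟩
  · obtain ⟨n, hn, hb⟩ := hbound R
    refine ⟨n, hn, fun x x' hx => hb _ (k x) (Or.inl (hk x)) (k x') (Or.inl (hk x')) ?_⟩
    rw [hαk, hα]
    exact hx.le
  · refine ⟨R * max M 0 + 1, by positivity, fun g g' hg => ?_⟩
    obtain ⟨l, hl, hlg, hln⟩ := exists_word hS (g⁻¹ * g')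
    have h1 := hprod l hl
    rw [hlg, hln, ← hdist, ← h.isometry g, smul_smul, mul_inv_cancel_left, dist_comm] at h1
    have h2 := mul_le_mul_of_nonneg_right hg.le (le_max_right M 0)
    linarith
  -- The element `(α (g • x₀))⁻¹ * g` carries `x₀` exactly to `k (g • x₀)`, so radius `0` suffices.
  · obtain ⟨n, hn, hb⟩ := hbound 0
    refine ⟨n, fun g => (hb _ (k (g • x₀)) (Or.inl (hk _)) x₀ (Or.inr rfl) ?_).le⟩
    rw [Function.comp_apply, id, hαk, dist_self]

end WordMetric

/-- The inverse picks, for each `b`, a point whose image is within `C` of `b`; the lower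
quasi-isometry bound makes it uniform. -/
theorem IsQuasiIsometry.exists_areCoarseInverses {A B : Type*} [MetricSpace A] [MetricSpace B]
    {f : A → B} (hf : IsQuasiIsometry dist dist f) : ∃ g : B → A, AreCoarseInverses f g := by
  obtain ⟨L, C, hL, hC, hLC, hsurj⟩ := hf
  have hL0 : 0 < L := one_pos.trans_le hL
  have hlow : ∀ a a', dist a a' ≤ L * (dist (f a) (f a') + C) := by
    intro a a'
    rw [← div_le_iff₀' hL0]
    linarith [(hLC a a').1]
  choose g hg using hsurj
  refine ⟨g, fun R hR => ⟨L * R + C + 1, by positivity, fun a a' ha => ?_⟩, fun R hR =>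
    ⟨L * (C + R + C + C) + 1, by positivity, fun b b' hb => ?_⟩, ⟨L * (C + C), fun a => ?_⟩, C, hg⟩
  · nlinarith [(hLC a a').2]
  · have h1 := dist_triangle4 (f (g b)) b b' (f (g b'))
    have h2 := hg b
    have h3 := hg b'
    rw [dist_comm] at h3
    have h4 : L * (dist (f (g b)) (f (g b')) + C) ≤ L * (C + R + C + C) :=
      mul_le_mul_of_nonneg_left (by linarith) hL0.le
    linarith [hlow (g b) (g b')]
  · exact (hlow _ _).trans (mul_le_mul_of_nonneg_left (add_le_add_left (hg (f a)) C) hL0.le)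

theorem theorem1p1 {G H : Type*} [Group G] [Group H] (hGH : QuasiIsometricGroups G H)
    {X : Type u} {Y : Type v} [MetricSpace X] [ProperSpace X] [MetricSpace Y] [ProperSpace Y]
    (hX : IsAR X) (hY : IsAR Y) [MulAction G X] [MulAction H Y]
    (hGX : IsGeometricAction G X) (hHY : IsGeometricAction H Y) :
    ProperHomotopyEquivalent X Y ∧
      ∃ (f : C(X, Y)) (g : C(Y, X)),
        IsCoarseEquivalence f ∧ IsCoarseEquivalence g ∧
        (∃ F : (g.comp f).Homotopy (ContinuousMap.id X), IsBoundedHomotopy F ∧ IsProperMap F) ∧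
        (∃ F : (f.comp g).Homotopy (ContinuousMap.id Y), IsBoundedHomotopy F ∧ IsProperMap F) := by
  have := hX.nonempty
  have := hY.nonempty
  obtain ⟨S, T, hSfin, hTfin, hS, hT, q, hq⟩ := hGH
  obtain ⟨φ, ψ, hφψ⟩ : ∃ (φ : X → Y) (ψ : Y → X), AreCoarseInverses φ ψ := by
    let := wordMetricSpace hS
    let := wordMetricSpace hT
    obtain ⟨α, β, hαβ⟩ := hGX.exists_areCoarseInverses hSfin hS
    obtain ⟨α', β', hαβ'⟩ := hHY.exists_areCoarseInverses hTfin hT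
    obtain ⟨q', hqq⟩ := IsQuasiIsometry.exists_areCoarseInverses (f := q) hq
    -- The function `X → Y` passes through the groups: `X → G → H → Y`.
    exact ⟨_, _, (hαβ.comp hqq).comp hαβ'.symm⟩
  obtain ⟨f, hf⟩ := hφψ.left_uniform.exists_continuous_boundedlyClose hGX
    (hY.hasUniformExtension hHY)
  obtain ⟨g, hg⟩ := hφψ.right_uniform.exists_continuous_boundedlyClose hHY
    (hX.hasUniformExtension hGX)
  have hfg := hφψ.of_boundedlyClose hf hg
  obtain ⟨F, hF⟩ := LargeScaleUniform.exists_isBoundedHomotopy hGX (hX.hasUniformExtension hGX)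
    (f₀ := g.comp f) (f₁ := ContinuousMap.id X) largeScaleUniform_id hfg.right_left
  obtain ⟨F', hF'⟩ := LargeScaleUniform.exists_isBoundedHomotopy hHY (hY.hasUniformExtension hHY)
    (f₀ := f.comp g) (f₁ := ContinuousMap.id Y) largeScaleUniform_id hfg.left_right
  exact ⟨⟨f, g, ⟨F, hF.isProperMap⟩, F', hF'.isProperMap⟩, f, g, hfg.isCoarseEquivalence,
    hfg.symm.isCoarseEquivalence, ⟨F, hF, hF.isProperMap⟩, F', hF', hF'.isProperMap⟩
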